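/- Let $m\ge 1$ and $n\ge 2$, and let $\mathbf A$ be a random $m\times n$ matrix whose columns are independent and identically distributed, each column having $m$ independent entries that are either all Gaussian with mean $0$ and variance $1/m$, or all uniformly distributed on $\{-1/\sqrt m,\,1/\sqrt m\}$ (symmetric Bernoulli). For two columns $\mathbf a_1,\mathbf a_2\in\mathbb R^m$ put $$\zeta(\mathbf a_1,\mathbf a_2)=\left|\frac{\mathbf a_1^T\mathbf a_2}{\|\mathbf a_1\|_2\,\|\mathbf a_2\|_2}\right| ,$$ for a set $\mathcal S$ of two column indices let $\zeta(\mathbf A_{\mathcal S})$ be the value of $\zeta$ at the two columns of $\mathbf A$ indexed by $\mathcal S$, and let $\mu(\mathbf A)=\max_{\mathcal S}\zeta(\mathbf A_{\mathcal S})$ be the mutual coherence of $\mathbf A$. For $a\ge 0$ let $$p(a)=\Pr\{\zeta(\mathbf A_{\mathcal S})>a\},\qquad q_1(a)=\Pr\{\zeta(\mathbf A_{\mathcal S})>a,\ \zeta(\mathbf A_{\mathcal R})>a\},$$ where $|\mathcal S|=|\mathcal R|=2$ and $|\mathcal S\cap\mathcal R|=1$ (these numbers do not depend on the choice of $\mathcal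 S,\mathcal R$; for $n=2$ there is no such $\mathcal R$, and $q_1$ does not enter below). Let $\lambda_n(a)=\binom n2 p(a)$, and let $$\varepsilon_n(a)=\bigl(1-e^{-\lambda_n(a)}\bigr)\left\{p(a)\left[\binom n2-\binom{n-2}2\right]+\binom21\binom{n-2}1\,\frac{q_1(a)}{p(a)}\right\}$$ be the Poisson approximation error (with $q_1(a)/p(a)$ read as $0$ if $p(a)=0$). Then, for every $a\ge 0$, $$\bigl|\Pr\{\mu(\mathbf A)\le a\}-e^{-\lambda_n(a)}\bigr|\le \varepsilon_n(a)$$ and $$\varepsilon_n(a)\le\bigl(1-e^{-\lambda_n(a)}\bigr)(4n-6)\,e^{-ma^2/2}+4n^3e^{-ma^2}.$$ Consequently the union bound $\Pr\{\mu(\mathbf A)>a\}\le\lambda_n(a)$ is tight for $a$ above $\sqrt{(4\log n)/m}$, in the following sense: for all $a\ge 0$, $$0\le\lambda_n(a)-\Pr\{\mu(\mathbf A)>a\}\le\tfrac12\lambda_n(a)^2+\varepsilon_n(a),$$ and if $a\ge\sqrt{(4\log n)/m+2t}$ with $t\ge0$, then $\lambda_n(a)\le e^{-mt}$ and $\varepsilon_n(a)\le\frac8n\,e^{-2mt}$.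 -/

import Mathlib

open MeasureTheory ProbabilityTheory
open scoped NNReal ENNReal

namespace Coherence

/-- The sets of `k` column indices out of `n`. -/
abbrev ColSet (n k : ℕ) : Type := {S : Finset (Fin n) // S.card = k}

/-- The `m × k` submatrix `A_S` formed by the columns of `A` with index in `S`, in increasing
order of the index. -/
def colSubmatrix {m n k : ℕ} (A : Matrix (Fin m) (Fin n) ℝ) (S : ColSet n k) :
    Matrix (Fin m) (Fin k) ℝ :=
  A.submatrix id (S.1.orderEmbOfFin S.2)

/-- The Euclidean norm of a vector of length `m`. -/
noncomputable def l2norm {m : ℕ} (x : Fin m → ℝ) : ℝ := ‖WithLp.toLp 2 x‖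

/-- The normalized-coherence kernel on `m × 2` matrices:
`ζ(a₁, a₂) = |a₁ᵀ a₂ / (‖a₁‖₂ ‖a₂‖₂)|`. -/
noncomputable def kernel {m : ℕ} (B : Matrix (Fin m) (Fin 2) ℝ) : ℝ :=
  |(B.col 0 ⬝ᵥ B.col 1) / (l2norm (B.col 0) * l2norm (B.col 1))|

/-- The mutual coherence of a matrix: the maximum of the kernel over all pairs of distinct
columns (a supremum over a finite set, nonempty as soon as `2 ≤ n`). -/
noncomputable def mutualCoherence {m n : ℕ} (A : Matrix (Fin m) (Fin n) ℝ) : ℝ :=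
  ⨆ S : ColSet n 2, kernel (colSubmatrix A S)

/-- The symmetric Bernoulli law on `{-1/√m, 1/√m}`. -/
noncomputable def symmBernoulli (m : ℕ) : Measure ℝ :=
  (2⁻¹ : ℝ≥0∞) • Measure.dirac (-(1 / √(m : ℝ))) + (2⁻¹ : ℝ≥0∞) • Measure.dirac (1 / √(m : ℝ))

/-- The columns of the random matrix `A` are independent, and each of them is a vector whose `m`
entries are independent with law `ν`. -/
structure IIDColumns {Ω : Type*} [MeasurableSpace Ω] (P : Measure Ω) {m n : ℕ}
    (A : Ω → Matrix (Fin m) (Fin n) ℝ) (ν : Measure ℝ) : Prop where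
  indep : iIndepFun (fun (j : Fin n) (ω : Ω) (i : Fin m) => A ω i j) P
  law : ∀ j : Fin n,
    HasLaw (fun (ω : Ω) (i : Fin m) => A ω i j) (Measure.pi (fun _ : Fin m => ν)) P

/-- The marginal tail probability `Pr{ζ(A_S) > a}`. -/
noncomputable def marginalTail {Ω : Type*} [MeasurableSpace Ω] (P : Measure Ω) {m n : ℕ}
    (A : Ω → Matrix (Fin m) (Fin n) ℝ) (a : ℝ) (S : ColSet n 2) : ℝ :=
  P.real {ω | a < kernel (colSubmatrix (A ω) S)}

/-- The joint tail probability `Pr{ζ(A_S) > a, ζ(A_R) > a}`. -/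
noncomputable def jointTail {Ω : Type*} [MeasurableSpace Ω] (P : Measure Ω) {m n : ℕ}
    (A : Ω → Matrix (Fin m) (Fin n) ℝ) (a : ℝ) (S R : ColSet n 2) : ℝ :=
  P.real {ω | a < kernel (colSubmatrix (A ω) S) ∧ a < kernel (colSubmatrix (A ω) R)}

/-- The sum of all marginal tail probabilities, `λ = C(n,k) p` (the union bound). -/
noncomputable def unionBound (n k : ℕ) (p : ℝ) : ℝ := (n.choose k : ℝ) * p

/-- The Poisson approximation error for a kernel on `k` out of `n` IID columns, with marginal tail
probability `p`, and with joint tail probability `q r` for two sets of `k` columns that share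
exactly `r` columns:
`(1 - e^{-λ}) { p [C(n,k) - C(n-k,k)] + ∑_{r=1}^{k-1} C(k,r) C(n-k,k-r) p⁻¹ q_r }`. -/
noncomputable def poissonError (n k : ℕ) (p : ℝ) (q : ℕ → ℝ) : ℝ :=
  (1 - Real.exp (-unionBound n k p)) *
    (p * ((n.choose k : ℝ) - ((n - k).choose k : ℝ)) +
      ∑ r ∈ Finset.Icc 1 (k - 1),
        (k.choose r : ℝ) * ((n - k).choose (k - r) : ℝ) * p⁻¹ * q r)

end Coherence

/-! The coherence is at most `a` exactly when the number `W` of column pairs with kernel above `a`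
is zero. Indicators of disjoint pairs involve independent columns, so `W` is a sum of locally
dependent indicators and is nearly Poisson. The Chen-Stein method
(`abs_measureReal_iInter_compl_sub_exp_le`) makes this quantitative: the Stein solution for `{0}`
takes values in `[0, (1 - e^{-λ})/λ]`, and this constant multiplies the sums of `p_i p_j` and of the
joint probabilities over neighbouring pairs. Counting the pairs that meet a given one turns the
bound into `poissonError`.

It remains to bound `p` and `q`. With one column fixed, the other must lie in one of two opposite
cones, each of probability at most `e = exp(-m a²/2)`. For Gaussian columns the superlevel sets of
the density are balls, and the part of a ball in the cone fits into a ball smaller by a factor at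
most `exp(-a²/2)` in radius. Bernoulli columns have norm 1 almost surely, and Hoeffding's inequality
applies. Hence `p ≤ 2e`, and conditioning on the shared column gives `q ≤ (2e)²`; the explicit
bounds follow by arithmetic. -/

namespace Coherence

/-! ### The Stein equation for the Poisson law at zero -/

/-- The solution of the Stein equation for the Poisson law with parameter `lam` and the
indicator function of `{0}`, as an integral. -/
noncomputable def steinFun (lam : ℝ) (k : ℕ) : ℝ :=
  ∫ y in (0 : ℝ)..1, y ^ (k - 1) * Real.exp (-lam * y)

lemma integral_exp_neg_mul {lam : ℝ} (h : lam ≠ 0) :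
    ∫ y in (0 : ℝ)..1, Real.exp (-lam * y) = (1 - Real.exp (-lam)) / lam := by
  rw [intervalIntegral.integral_comp_mul_left _ (neg_ne_zero.mpr h)]
  simp only [integral_exp, smul_eq_mul, mul_zero, mul_one, Real.exp_zero]
  field_simp
  ring

lemma steinFun_nonneg (lam : ℝ) (k : ℕ) : 0 ≤ steinFun lam k :=
  intervalIntegral.integral_nonneg zero_le_one fun _ hy =>
    mul_nonneg (pow_nonneg hy.1 _) (Real.exp_pos _).le

lemma steinFun_le {lam : ℝ} (h : lam ≠ 0) (k : ℕ) :
    steinFun lam k ≤ (1 - Real.exp (-lam)) / lam := by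
  rw [← integral_exp_neg_mul h]
  refine intervalIntegral.integral_mono_on zero_le_one
    (Continuous.intervalIntegrable (by fun_prop) _ _)
    (Continuous.intervalIntegrable (by fun_prop) _ _) fun y hy => ?_
  exact mul_le_of_le_one_left (Real.exp_pos _).le (pow_le_one₀ hy.1 hy.2)

/-- Both values lie in `[0, (1 - e^{-λ})/λ]`; this bound on the oscillation is the only smoothness
needed. -/
lemma abs_steinFun_sub_le {lam : ℝ} (h : lam ≠ 0) (j k : ℕ) :
    |steinFun lam j - steinFun lam k| ≤ (1 - Real.exp (-lam)) / lam := by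
  have h1 := steinFun_nonneg lam j
  have h2 := steinFun_nonneg lam k
  have h3 := steinFun_le h j
  have h4 := steinFun_le h k
  rw [abs_le]
  constructor <;> linarith

/-- For `k ≥ 1`, integrate the derivative of `y ^ k * exp (-lam * y)` over `[0, 1]`. At `k = 0` the
truncated exponent in `steinFun lam 0` is harmless because its coefficient vanishes. -/
lemma steinFun_succ {lam : ℝ} (h : lam ≠ 0) (k : ℕ) :
    lam * steinFun lam (k + 1) - k * steinFun lam k
      = (if k = 0 then 1 else 0) - Real.exp (-lam) := by
  rcases Nat.eq_zero_or_pos k with rfl | hk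
  · simp only [steinFun, zero_add, Nat.sub_self, pow_zero, one_mul, integral_exp_neg_mul h,
      Nat.cast_zero, zero_mul, sub_zero, if_true]
    field_simp
  · obtain ⟨k, rfl⟩ := Nat.exists_eq_add_of_le' hk
    have hparts := intervalIntegral.integral_eq_sub_of_hasDerivAt
      (f := fun y : ℝ => y ^ (k + 1) * Real.exp (-lam * y))
      (f' := fun y : ℝ => ((k + 1 : ℕ) : ℝ) * (y ^ k * Real.exp (-lam * y))
        - lam * (y ^ (k + 1) * Real.exp (-lam * y))) (a := 0) (b := 1)
      (fun y _ => by
        have h1 := hasDerivAt_pow (k + 1) y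
        have h2 : HasDerivAt (fun y : ℝ => Real.exp (-lam * y)) (Real.exp (-lam * y) * -lam) y := by
          simpa using ((hasDerivAt_id y).const_mul (-lam)).exp
        refine (h1.mul h2).congr_deriv ?_
        rw [Nat.add_sub_cancel]
        ring)
      (Continuous.intervalIntegrable (by fun_prop) _ _)
    rw [intervalIntegral.integral_sub (Continuous.intervalIntegrable (by fun_prop) _ _)
      (Continuous.intervalIntegrable (by fun_prop) _ _), intervalIntegral.integral_const_mul,
      intervalIntegral.integral_const_mul] at hparts
    have h1 : (0 : ℝ) ^ (k + 1) = 0 := zero_pow (Nat.succ_ne_zero k)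
    simp only [one_pow, mul_one, one_mul, h1, zero_mul, sub_zero] at hparts
    rw [if_neg (Nat.succ_ne_zero k)]
    simp only [steinFun, Nat.add_sub_cancel]
    linarith

/-! ### The Chen-Stein bound under local dependence -/

section ChenStein

variable {Ω : Type*} [MeasurableSpace Ω] {P : Measure Ω} [IsProbabilityMeasure P]

lemma integrable_of_abs_le {g : Ω → ℝ} (hg : Measurable g) (C : ℝ) (h : ∀ ω, |g ω| ≤ C) :
    Integrable g P :=
  Integrable.of_bound hg.aestronglyMeasurable C (Filter.Eventually.of_forall h)

/-- The Chen-Stein bound for the probability that none of finitely many dissociated events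
occurs: `B i` is a neighbourhood of `i` such that the event `E i` is independent of the number of
events outside of it that occur. -/
theorem abs_measureReal_iInter_compl_sub_exp_le {ι : Type*} [Fintype ι] [DecidableEq ι]
    (E : ι → Set Ω) (hE : ∀ i, MeasurableSet (E i)) (B : ι → Finset ι) (hB : ∀ i, i ∈ B i)
    (hind : ∀ i, IndepFun ((E i).indicator (1 : Ω → ℕ))
      (fun ω => ∑ j ∈ (B i)ᶜ, (E j).indicator (1 : Ω → ℕ) ω) P)
    (hpos : ∑ i, P.real (E i) ≠ 0) :
    |P.real (⋂ i, (E i)ᶜ) - Real.exp (-∑ i, P.real (E i))| ≤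
      (1 - Real.exp (-∑ i, P.real (E i))) / (∑ i, P.real (E i)) *
        (∑ i, ∑ j ∈ B i, P.real (E i) * P.real (E j)
          + ∑ i, ∑ j ∈ (B i).erase i, P.real (E i ∩ E j)) := by
  set lam := ∑ i, P.real (E i) with hlam
  set C := (1 - Real.exp (-lam)) / lam with hC
  set f := steinFun lam with hf
  set X : ι → Ω → ℕ := fun i => (E i).indicator 1 with hX
  set W : Ω → ℕ := fun ω => ∑ i, X i ω with hW
  set V : ι → Ω → ℕ := fun i ω => ∑ j ∈ (B i)ᶜ, X j ω with hV
  have hXm : ∀ i, Measurable (X i) := fun i => measurable_one.indicator (hE i)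
  have hWm : Measurable W := Finset.measurable_sum _ fun i _ => hXm i
  have hVm : ∀ i, Measurable (V i) := fun i => Finset.measurable_sum _ fun j _ => hXm j
  have hX01 : ∀ i ω, X i ω = 0 ∨ X i ω = 1 := fun i ω => by
    by_cases h : ω ∈ E i <;> simp [hX, h]
  have hXr : ∀ i ω, (X i ω : ℝ) = (E i).indicator 1 ω := fun i ω => by
    by_cases h : ω ∈ E i <;> simp [hX, h]
  have hXint : ∀ i, ∫ ω, (X i ω : ℝ) ∂P = P.real (E i) := fun i => by
    simp_rw [hXr]; exact integral_indicator_one (hE i)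
  have hXXint : ∀ i j, ∫ ω, (X i ω : ℝ) * X j ω ∂P = P.real (E i ∩ E j) := fun i j => by
    rw [← integral_indicator_one ((hE i).inter (hE j))]
    refine integral_congr_ae (Filter.Eventually.of_forall fun ω => ?_)
    simp only [hXr, Set.inter_indicator_one, Pi.mul_apply]
  have hWV : ∀ i ω, W ω = V i ω + ∑ j ∈ B i, X j ω := fun i ω => by
    simp only [hW, hV]; rw [add_comm, Finset.sum_add_sum_compl]
  have hmeasR : ∀ {Y : Ω → ℕ}, Measurable Y → ∀ g : ℕ → ℝ, Measurable fun ω => g (Y ω) :=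
    fun hY g => (measurable_of_countable g).comp hY
  have hC0 : 0 ≤ C := (steinFun_nonneg lam 0).trans (steinFun_le hpos 0)
  have hfabs : ∀ k, |f k| ≤ C := fun k => by
    rw [abs_of_nonneg (steinFun_nonneg lam k)]; exact steinFun_le hpos k
  have hXabs : ∀ i ω, |(X i ω : ℝ)| ≤ 1 := fun i ω => by
    rcases hX01 i ω with h | h <;> simp [h]
  have hXi : ∀ i, Integrable (fun ω => (X i ω : ℝ)) P := fun i =>
    integrable_of_abs_le (hmeasR (hXm i) _) 1 (hXabs i)
  have hXXi : ∀ i j, Integrable (fun ω => (X i ω : ℝ) * X j ω) P := fun i j =>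
    integrable_of_abs_le ((hmeasR (hXm i) _).mul (hmeasR (hXm j) _)) 1 fun ω => by
      rw [abs_mul]; exact mul_le_one₀ (hXabs i ω) (abs_nonneg _) (hXabs j ω)
  -- As `s` is an integer, either it is zero or the oscillation bound `C` is already at most `C *
  -- s`.
  have hdiff : ∀ j k : ℕ, ∀ s : ℕ, j = k + s → |f j - f k| ≤ C * s := fun j k s h => by
    rcases Nat.eq_zero_or_pos s with rfl | hs
    · simp [h]
    · exact (abs_steinFun_sub_le hpos j k).trans
        (le_mul_of_one_le_right hC0 (by exact_mod_cast hs))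
  -- the three parts of a summand of the Stein equation
  set T1 : ι → Ω → ℝ := fun i ω => P.real (E i) * (f (W ω + 1) - f (V i ω + 1)) with hT1
  set T2 : ι → Ω → ℝ := fun i ω => (X i ω : ℝ) * (f (V i ω + 1) - f (W ω)) with hT2
  set T3 : ι → Ω → ℝ := fun i ω => P.real (E i) * f (V i ω + 1) - X i ω * f (V i ω + 1) with hT3
  have hfW : Integrable (fun ω => f (W ω)) P := integrable_of_abs_le (hmeasR hWm f) C fun _ => hfabs _
  have hfW1 : Integrable (fun ω => f (W ω + 1)) P :=
    integrable_of_abs_le (hmeasR hWm fun k => f (k + 1)) C fun _ => hfabs _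
  have hfV : ∀ i, Integrable (fun ω => f (V i ω + 1)) P := fun i =>
    integrable_of_abs_le (hmeasR (hVm i) fun k => f (k + 1)) C fun _ => hfabs _
  have hXg : ∀ i, ∀ {g : Ω → ℝ}, Integrable g P → Integrable (fun ω => (X i ω : ℝ) * g ω) P :=
    fun i g hg => hg.bdd_mul (hmeasR (hXm i) _).aestronglyMeasurable
      (Filter.Eventually.of_forall (hXabs i))
  have hT1i : ∀ i, Integrable (T1 i) P := fun i => (hfW1.sub (hfV i)).const_mul _
  have hT2i : ∀ i, Integrable (T2 i) P := fun i => hXg i ((hfV i).sub hfW)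
  have hT3i : ∀ i, Integrable (T3 i) P := fun i => ((hfV i).const_mul _).sub (hXg i (hfV i))
  -- Only here does independence enter: `X i` has mean `P.real (E i)` and is independent of `V i`.
  have hT3z : ∀ i, ∫ ω, T3 i ω ∂P = 0 := fun i => by
    have hi : IndepFun (fun ω => (X i ω : ℝ)) (fun ω => f (V i ω + 1)) P :=
      (hind i).comp (measurable_of_countable fun k : ℕ => (k : ℝ))
        (measurable_of_countable fun k : ℕ => f (k + 1))
    simp only [hT3]
    rw [integral_sub ((hfV i).const_mul _) (hXg i (hfV i)), integral_const_mul,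
      hi.integral_fun_mul_eq_mul_integral (hXi i).aestronglyMeasurable (hfV i).aestronglyMeasurable,
      hXint, sub_self]
  have hT1b : ∀ i, |∫ ω, T1 i ω ∂P| ≤ C * ∑ j ∈ B i, P.real (E i) * P.real (E j) := fun i => by
    refine (abs_integral_le_integral_abs).trans ?_
    have : ∫ ω, C * ∑ j ∈ B i, P.real (E i) * (X j ω : ℝ) ∂P
        = C * ∑ j ∈ B i, P.real (E i) * P.real (E j) := by
      rw [integral_const_mul, integral_finsetSum _ fun j _ => (hXi j).const_mul _]
      simp_rw [integral_const_mul, hXint]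
    rw [← this]
    refine integral_mono (hT1i i).abs
      ((integrable_finsetSum _ fun j _ => (hXi j).const_mul _).const_mul _) fun ω => ?_
    simp only [hT1]
    rw [abs_mul, abs_of_nonneg measureReal_nonneg, ← Finset.mul_sum, mul_left_comm]
    refine mul_le_mul_of_nonneg_left ?_ measureReal_nonneg
    have := hdiff (W ω + 1) (V i ω + 1) (∑ j ∈ B i, X j ω) (by rw [hWV i ω]; ring)
    simpa using this
  have hT2b : ∀ i, |∫ ω, T2 i ω ∂P| ≤ C * ∑ j ∈ (B i).erase i, P.real (E i ∩ E j) := fun i => by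
    refine (abs_integral_le_integral_abs).trans ?_
    have : ∫ ω, C * ∑ j ∈ (B i).erase i, (X i ω : ℝ) * (X j ω : ℝ) ∂P
        = C * ∑ j ∈ (B i).erase i, P.real (E i ∩ E j) := by
      rw [integral_const_mul, integral_finsetSum _ fun j _ => hXXi i j]
      simp_rw [hXXint]
    rw [← this]
    refine integral_mono (hT2i i).abs
      ((integrable_finsetSum _ fun j _ => hXXi i j).const_mul _) fun ω => ?_
    simp only [hT2]
    rw [abs_mul, ← Finset.mul_sum, mul_left_comm]
    -- The factor `X i` allows assuming `X i = 1`; then `W` exceeds `V i + 1` by the sum over the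
    -- other neighbours, so `i` itself drops out.
    rcases hX01 i ω with h | h
    · simp [h]
    · have := hdiff (W ω) (V i ω + 1) (∑ j ∈ (B i).erase i, X j ω) (by
        rw [hWV i ω, ← Finset.add_sum_erase _ _ (hB i), h]; ring)
      rw [abs_sub_comm] at this
      simpa [h] using this
  -- The Stein equation at `W`, with `lam` and `W` expanded as sums over `i`; inserting `f (V i +
  -- 1)` splits each summand into `T1 + T2 + T3`.
  have hid : ∀ ω, (⋂ i, (E i)ᶜ).indicator (1 : Ω → ℝ) ω - Real.exp (-lam)
      = ∑ i, (T1 i ω + T2 i ω + T3 i ω) := fun ω => by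
    have h1 : (⋂ i, (E i)ᶜ).indicator (1 : Ω → ℝ) ω = if W ω = 0 then 1 else 0 := by
      have : ω ∈ (⋂ i, (E i)ᶜ) ↔ W ω = 0 := by
        simp [hW, hX, Finset.sum_eq_zero_iff]
      by_cases h : W ω = 0
      · rw [if_pos h, Set.indicator_of_mem (this.2 h)]; rfl
      · rw [if_neg h, Set.indicator_of_notMem (fun h' => h (this.1 h'))]
    rw [h1, ← steinFun_succ hpos]
    have h2 : ((W ω : ℕ) : ℝ) = ∑ i, (X i ω : ℝ) := by simp [hW]
    rw [h2, hlam, Finset.sum_mul, Finset.sum_mul, ← Finset.sum_sub_distrib]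
    refine Finset.sum_congr rfl fun i _ => ?_
    simp only [hT1, hT2, hT3, hf, ← hlam]
    ring
  have hmI : MeasurableSet (⋂ i, (E i)ᶜ) := MeasurableSet.iInter fun i => (hE i).compl
  have hmain : P.real (⋂ i, (E i)ᶜ) - Real.exp (-lam)
      = ∑ i, (∫ ω, T1 i ω ∂P + ∫ ω, T2 i ω ∂P) := by
    have h1 : ∫ ω, ((⋂ i, (E i)ᶜ).indicator (1 : Ω → ℝ) ω - Real.exp (-lam)) ∂P
        = P.real (⋂ i, (E i)ᶜ) - Real.exp (-lam) := by
      have hi : Integrable ((⋂ i, (E i)ᶜ).indicator (1 : Ω → ℝ)) P :=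
        (integrable_const (1 : ℝ)).indicator hmI
      rw [integral_sub hi (integrable_const _), integral_indicator_one hmI]
      simp
    rw [← h1]
    simp_rw [hid]
    rw [integral_finsetSum (f := fun i ω => T1 i ω + T2 i ω + T3 i ω) _
      fun i _ => ((hT1i i).add (hT2i i)).add (hT3i i)]
    refine Finset.sum_congr rfl fun i _ => ?_
    have e1 := integral_add ((hT1i i).add (hT2i i)) (hT3i i)
    have e2 := integral_add (hT1i i) (hT2i i)
    simp only [Pi.add_apply] at e1
    rw [e1, e2, hT3z, add_zero]
  rw [hmain, ← Finset.sum_add_distrib, Finset.mul_sum]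
  refine (Finset.abs_sum_le_sum_abs _ _).trans (Finset.sum_le_sum fun i _ => ?_)
  rw [mul_add]
  exact (abs_add_le _ _).trans (add_le_add (hT1b i) (hT2b i))

end ChenStein

/-! ### Counting pairs of indices that meet a given pair -/

section Combinatorics

variable {n : ℕ}

/-- The `i`-th smallest element of a set of `k` column indices. -/
noncomputable abbrev ColSet.elem {k : ℕ} (S : ColSet n k) (i : Fin k) : Fin n :=
  S.1.orderEmbOfFin S.2 i

lemma ColSet.elem_mem {k : ℕ} (S : ColSet n k) (i : Fin k) : S.elem i ∈ S.1 :=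
  Finset.orderEmbOfFin_mem _ _ _

lemma ColSet.elem_zero_ne_elem_one (S : ColSet n 2) : S.elem 0 ≠ S.elem 1 := fun h =>
  zero_ne_one ((S.1.orderEmbOfFin S.2).injective h)

lemma ColSet.elem_eq_or (S : ColSet n 2) {i j : Fin n} (hS : S.1 = {i, j}) :
    (S.elem 0 = i ∧ S.elem 1 = j) ∨ (S.elem 0 = j ∧ S.elem 1 = i) := by
  have h0 := S.elem_mem 0
  have h1 := S.elem_mem 1
  have h := S.elem_zero_ne_elem_one
  simp only [hS, Finset.mem_insert, Finset.mem_singleton] at h0 h1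
  grind

lemma card_colSet (n k : ℕ) : Fintype.card (ColSet n k) = n.choose k := by
  simp

/-- The sets of column indices that meet `S`. -/
def meeting {k : ℕ} (S : ColSet n k) : Finset (ColSet n k) :=
  Finset.univ.filter fun R => ¬Disjoint R.1 S.1

lemma self_mem_meeting (S : ColSet n 2) : S ∈ meeting S := by
  have : S.1.Nonempty := by rw [← Finset.card_pos, S.2]; norm_num
  simpa [meeting] using this.ne_empty

lemma card_meeting {k : ℕ} (S : ColSet n k) :
    (meeting S).card + (n - k).choose k = n.choose k := by
  have h1 : ((Finset.univ : Finset (ColSet n k)).filter fun R => Disjoint R.1 S.1).card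
      = (n - k).choose k := by
    rw [← Finset.card_map (Function.Embedding.subtype _)]
    have : ((Finset.univ : Finset (ColSet n k)).filter fun R => Disjoint R.1 S.1).map
        (Function.Embedding.subtype _) = Finset.powersetCard k (S.1ᶜ) := by
      ext T
      simp only [Finset.mem_map, Finset.mem_filter, Finset.mem_univ, true_and,
        Function.Embedding.coe_subtype, Subtype.exists, Finset.mem_powersetCard,
        Finset.subset_compl_iff_disjoint_right]
      constructor
      · rintro ⟨a, b, h, rfl⟩; exact ⟨h, b⟩
      · rintro ⟨h, b⟩; exact ⟨T, b, h, rfl⟩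
    rw [this, Finset.card_powersetCard, Finset.card_compl, S.2, Fintype.card_fin]
  rw [← h1, ← card_colSet n k, ← Finset.card_univ, add_comm, meeting]
  exact Finset.card_filter_add_card_filter_not _

lemma choose_two_eq (hn : 2 ≤ n) : n.choose 2 = (n - 2).choose 2 + (2 * (n - 2) + 1) := by
  obtain ⟨k, rfl⟩ := Nat.exists_eq_add_of_le' hn
  simp only [Nat.add_sub_cancel]
  rw [Nat.choose_succ_succ' (k + 1) 1, Nat.choose_succ_succ' k 1]
  simp
  ring

lemma card_erase_meeting (hn : 2 ≤ n) (S : ColSet n 2) :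
    ((meeting S).erase S).card = 2 * (n - 2) := by
  rw [Finset.card_erase_of_mem (self_mem_meeting S)]
  have h1 := card_meeting S
  have h2 := choose_two_eq hn
  omega

lemma card_inter_of_mem_erase_meeting {S R : ColSet n 2} (h : R ∈ (meeting S).erase S) :
    (S.1 ∩ R.1).card = 1 := by
  simp only [meeting, Finset.mem_erase, Finset.mem_filter, Finset.mem_univ, true_and] at h
  obtain ⟨hne, hd⟩ := h
  have h1 : 0 < (S.1 ∩ R.1).card := by
    rw [Finset.card_pos, Finset.nonempty_iff_ne_empty, ne_eq, ← Finset.disjoint_iff_inter_eq_empty]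
    exact fun h => hd h.symm
  have h2 : (S.1 ∩ R.1).card < 2 := by
    by_contra! h2
    have e1 := Finset.eq_of_subset_of_card_le (Finset.inter_subset_left (s₁ := S.1) (s₂ := R.1))
      (by rw [S.2]; exact h2)
    have e2 := Finset.eq_of_subset_of_card_le (Finset.inter_subset_right (s₁ := S.1) (s₂ := R.1))
      (by rw [R.2]; exact h2)
    exact hne (Subtype.ext (e2.symm.trans e1))
  omega

lemma exists_of_card_inter {S R : ColSet n 2} (h : (S.1 ∩ R.1).card = 1) :
    ∃ i j k : Fin n, i ≠ j ∧ i ≠ k ∧ j ≠ k ∧ S.1 = {i, j} ∧ R.1 = {i, k} := by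
  obtain ⟨i, hi⟩ := Finset.card_eq_one.1 h
  have hiS : i ∈ S.1 := Finset.mem_of_mem_inter_left (hi ▸ Finset.mem_singleton_self i)
  have hiR : i ∈ R.1 := Finset.mem_of_mem_inter_right (hi ▸ Finset.mem_singleton_self i)
  have other : ∀ T : ColSet n 2, i ∈ T.1 → ∃ j, i ≠ j ∧ T.1 = {i, j} := fun T hT => by
    obtain ⟨x, y, hxy, hT'⟩ := Finset.card_eq_two.1 T.2
    rw [hT'] at hT
    rcases Finset.mem_insert.1 hT with rfl | hT
    · exact ⟨y, hxy, hT'⟩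
    · obtain rfl := Finset.mem_singleton.1 hT
      exact ⟨x, hxy.symm, hT'.trans (Finset.pair_comm _ _)⟩
  obtain ⟨j, hij, hS⟩ := other S hiS
  obtain ⟨k, hik, hR⟩ := other R hiR
  refine ⟨i, j, k, hij, hik, ?_, hS, hR⟩
  rintro rfl
  rw [hS, hR, Finset.inter_self, Finset.card_pair hij] at h
  omega

end Combinatorics

/-! ### Pair events for IID variables -/

section Pairs

variable {Ω E : Type*} {n : ℕ} {X : Fin n → Ω → E} {D : Set (E × E)}

/-- The event that the pair of the variables with index in `S` lies in `D`. -/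
def pairEvent (X : Fin n → Ω → E) (D : Set (E × E)) (S : ColSet n 2) : Set Ω :=
  {ω | (X (S.elem 0) ω, X (S.elem 1) ω) ∈ D}

lemma pairEvent_eq (hsymm : ∀ x y, (x, y) ∈ D ↔ (y, x) ∈ D) (S : ColSet n 2) {i j : Fin n}
    (hS : S.1 = {i, j}) : pairEvent X D S = {ω | (X i ω, X j ω) ∈ D} := by
  ext ω
  rcases S.elem_eq_or hS with ⟨h0, h1⟩ | ⟨h0, h1⟩ <;>
    simp only [pairEvent, Set.mem_ofPred_eq, h0, h1]
  exact hsymm _ _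

variable [MeasurableSpace Ω] [MeasurableSpace E]

/-- The probability that two IID variables with law `μ` form a pair in `D`. -/
noncomputable def pairProb (μ : Measure E) (D : Set (E × E)) : ℝ := (μ.prod μ).real D

/-- The probability that, of three IID variables with law `μ`, the third one forms a pair in `D`
with each of the two others. -/
noncomputable def pathProb (μ : Measure E) (D : Set (E × E)) : ℝ :=
  ((μ.prod μ).prod μ).real {z | (z.2, z.1.1) ∈ D ∧ (z.2, z.1.2) ∈ D}

variable {P : Measure Ω} {μ : Measure E}

lemma measurableSet_pairEvent (hX : ∀ j, Measurable (X j)) (hD : MeasurableSet D)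
    (S : ColSet n 2) : MeasurableSet (pairEvent X D S) :=
  ((hX _).prodMk (hX _)) hD

lemma measurableSet_path (hD : MeasurableSet D) :
    MeasurableSet {z : (E × E) × E | (z.2, z.1.1) ∈ D ∧ (z.2, z.1.2) ∈ D} :=
  ((measurable_snd.prodMk measurable_fst.fst) hD).inter
    ((measurable_snd.prodMk measurable_fst.snd) hD)

lemma measureReal_pairEvent [IsProbabilityMeasure P] (hX : ∀ j, Measurable (X j)) (hind : iIndepFun X P)
    (hlaw : ∀ j, P.map (X j) = μ) (hD : MeasurableSet D) (S : ColSet n 2) :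
    P.real (pairEvent X D S) = pairProb μ D := by
  have h := (indepFun_iff_map_prod_eq_prod_map_map (hX _).aemeasurable (hX _).aemeasurable).1
    (hind.indepFun S.elem_zero_ne_elem_one)
  rw [hlaw, hlaw] at h
  rw [pairProb, ← h, map_measureReal_apply ((hX _).prodMk (hX _)) hD]
  rfl

lemma measureReal_pairEvent_inter [IsProbabilityMeasure P] (hX : ∀ j, Measurable (X j)) (hind : iIndepFun X P)
    (hlaw : ∀ j, P.map (X j) = μ) (hD : MeasurableSet D)
    (hsymm : ∀ x y, (x, y) ∈ D ↔ (y, x) ∈ D) {S R : ColSet n 2} (h : (S.1 ∩ R.1).card = 1) :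
    P.real (pairEvent X D S ∩ pairEvent X D R) = pathProb μ D := by
  obtain ⟨i, j, k, hij, hik, hjk, hS, hR⟩ := exists_of_card_inter h
  have h1 := (indepFun_iff_map_prod_eq_prod_map_map (hX _).aemeasurable (hX _).aemeasurable).1
    (hind.indepFun hjk)
  have h2 := (indepFun_iff_map_prod_eq_prod_map_map ((hX j).prodMk (hX k)).aemeasurable
    (hX i).aemeasurable).1 (hind.indepFun_prodMk hX j k i hij.symm hik.symm)
  rw [h1, hlaw, hlaw, hlaw] at h2
  rw [pathProb, ← h2, map_measureReal_apply (((hX j).prodMk (hX k)).prodMk (hX i))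
    (measurableSet_path hD), pairEvent_eq hsymm S hS, pairEvent_eq hsymm R hR]
  rfl

/-- The two sides are functions of the variables indexed by `S` and by its complement, which are
independent blocks. -/
lemma indepFun_indicator_pairEvent (hX : ∀ j, Measurable (X j)) (hind : iIndepFun X P)
    (hD : MeasurableSet D) (S : ColSet n 2) :
    IndepFun ((pairEvent X D S).indicator (1 : Ω → ℕ))
      (fun ω => ∑ R ∈ (meeting S)ᶜ, (pairEvent X D R).indicator (1 : Ω → ℕ) ω) P := by
  have h := hind.indepFun_finset S.1 S.1ᶜ disjoint_compl_right hX
  -- The indicator of the pair event as a function of the block `T` alone; the default 0 is never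
  -- reached for the sets `R` used below.
  let count : ∀ (T : Finset (Fin n)) (R : ColSet n 2), (T → E) → ℕ := fun T R t =>
    if h : R.1 ⊆ T then
      {t : T → E | (t ⟨R.elem 0, h (R.elem_mem 0)⟩, t ⟨R.elem 1, h (R.elem_mem 1)⟩) ∈ D}.indicator
        1 t
    else 0
  have hcount : ∀ T R, Measurable (count T R) := fun T R => by
    by_cases h : R.1 ⊆ T
    · simp only [count, h, dif_pos]
      exact measurable_one.indicator
        (((measurable_pi_apply _).prodMk (measurable_pi_apply _)) hD)
    · simp only [count, h, dif_neg, not_false_eq_true]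
      exact measurable_const
  have hcomp : ∀ (T : Finset (Fin n)) (R : ColSet n 2), R.1 ⊆ T → ∀ ω,
      count T R (fun i : T => X i ω) = (pairEvent X D R).indicator (1 : Ω → ℕ) ω :=
    fun T R hR ω => by
      simp only [count, hR, dif_pos]
      rfl
  have := h.comp (hcount S.1 S)
    (Finset.measurable_sum (f := fun R => count S.1ᶜ R) (meeting S)ᶜ fun R _ => hcount _ R)
  convert this using 1
  · funext ω
    exact (hcomp _ _ subset_rfl ω).symm
  · funext ω
    simp only [Function.comp_apply]
    refine Finset.sum_congr rfl fun R hR => (hcomp _ _ ?_ ω).symm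
    simp only [meeting, Finset.mem_compl, Finset.mem_filter, Finset.mem_univ, true_and,
      not_not] at hR
    exact Finset.subset_compl_iff_disjoint_right.2 hR

/-- Poisson approximation of the probability that no pair out of `n` IID variables lies in a
symmetric set `D`. -/
theorem abs_measureReal_iInter_pairEvent_compl_sub_exp_le [IsProbabilityMeasure P] (hn : 2 ≤ n)
    (hX : ∀ j, Measurable (X j)) (hind : iIndepFun X P)
    (hlaw : ∀ j, P.map (X j) = μ) (hD : MeasurableSet D)
    (hsymm : ∀ x y, (x, y) ∈ D ↔ (y, x) ∈ D) :
    |P.real (⋂ S, (pairEvent X D S)ᶜ) - Real.exp (-unionBound n 2 (pairProb μ D))| ≤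
      poissonError n 2 (pairProb μ D) (fun _ => pathProb μ D) := by
  have hsum : ∑ S : ColSet n 2, P.real (pairEvent X D S) = unionBound n 2 (pairProb μ D) := by
    simp_rw [measureReal_pairEvent hX hind hlaw hD]
    rw [Finset.sum_const, Finset.card_univ, card_colSet, nsmul_eq_mul, unionBound]
  have hchoose : 0 < n.choose 2 := Nat.choose_pos hn
  -- The Chen-Stein bound divides by `λ`; for `p = 0` almost surely no pair event occurs and both
  -- sides vanish.
  by_cases hp : pairProb μ D = 0
  · have h0 : P.real (⋃ S, pairEvent X D S) = 0 := by
      refine le_antisymm ((measureReal_iUnion_fintype_le _).trans ?_) measureReal_nonneg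
      rw [hsum, hp, unionBound, mul_zero]
    rw [← Set.compl_iUnion, probReal_compl_eq_one_sub
      (MeasurableSet.iUnion fun S => measurableSet_pairEvent hX hD S), h0, hp]
    simp [unionBound, poissonError]
  have hpos : unionBound n 2 (pairProb μ D) ≠ 0 :=
    mul_ne_zero (by exact_mod_cast hchoose.ne') hp
  have h := abs_measureReal_iInter_compl_sub_exp_le (pairEvent X D)
    (measurableSet_pairEvent hX hD) meeting self_mem_meeting
    (indepFun_indicator_pairEvent hX hind hD) (by rwa [hsum])
  rw [hsum] at h
  refine h.trans (le_of_eq ?_)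
  have h2 : ∀ S : ColSet n 2, ∑ R ∈ (meeting S).erase S, P.real (pairEvent X D S ∩ pairEvent X D R)
      = (2 * (n - 2) : ℕ) * pathProb μ D := fun S => by
    rw [Finset.sum_congr rfl fun R hR => measureReal_pairEvent_inter hX hind hlaw hD hsymm
      (card_inter_of_mem_erase_meeting hR), Finset.sum_const, card_erase_meeting hn, nsmul_eq_mul]
  have h1 : ∀ S : ColSet n 2, ((meeting S).card : ℝ) = (n.choose 2 : ℝ) - ((n - 2).choose 2 : ℝ) :=
    fun S => by
      rw [eq_sub_iff_add_eq]
      exact_mod_cast card_meeting S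
  simp_rw [h2, measureReal_pairEvent hX hind hlaw hD]
  simp only [Finset.sum_const, nsmul_eq_mul, h1, Finset.card_univ, card_colSet]
  rw [poissonError]
  have hc : (n.choose 2 : ℝ) ≠ 0 := by exact_mod_cast hchoose.ne'
  simp only [unionBound, Nat.add_one_sub_one, Finset.Icc_self, Finset.sum_singleton,
    Nat.choose_one_right, Nat.cast_mul, Nat.cast_ofNat]
  field_simp

lemma pairProb_le [IsProbabilityMeasure μ] (hD : MeasurableSet D) {c : ℝ} (hc : 0 ≤ c)
    (h : ∀ x, μ.real (Prod.mk x ⁻¹' D) ≤ c) : pairProb μ D ≤ c := by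
  refine ENNReal.toReal_le_of_le_ofReal hc ?_
  rw [Measure.prod_apply hD]
  calc ∫⁻ x, μ (Prod.mk x ⁻¹' D) ∂μ ≤ ∫⁻ _, ENNReal.ofReal c ∂μ :=
        lintegral_mono fun x =>
          (ENNReal.le_ofReal_iff_toReal_le (measure_ne_top _ _) hc).2 (h x)
    _ = ENNReal.ofReal c := by simp

/-- Given the shared variable, the section is a product set, so its probability is the square of
that of a section of `D`. -/
lemma pathProb_le [IsProbabilityMeasure μ] (hD : MeasurableSet D) {c : ℝ} (hc : 0 ≤ c)
    (h : ∀ x, μ.real (Prod.mk x ⁻¹' D) ≤ c) : pathProb μ D ≤ c ^ 2 := by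
  refine ENNReal.toReal_le_of_le_ofReal (sq_nonneg c) ?_
  rw [Measure.prod_apply_symm (measurableSet_path hD)]
  calc ∫⁻ x, (μ.prod μ) ((fun z => (z, x)) ⁻¹'
          {z : (E × E) × E | (z.2, z.1.1) ∈ D ∧ (z.2, z.1.2) ∈ D}) ∂μ
      ≤ ∫⁻ _, ENNReal.ofReal (c ^ 2) ∂μ := lintegral_mono fun x => by
        have hx : μ (Prod.mk x ⁻¹' D) ≤ ENNReal.ofReal c :=
          (ENNReal.le_ofReal_iff_toReal_le (measure_ne_top _ _) hc).2 (h x)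
        have : (fun z => (z, x)) ⁻¹' {z : (E × E) × E | (z.2, z.1.1) ∈ D ∧ (z.2, z.1.2) ∈ D}
            = (Prod.mk x ⁻¹' D) ×ˢ (Prod.mk x ⁻¹' D) := rfl
        rw [this, Measure.prod_prod, sq, ENNReal.ofReal_mul hc]
        exact mul_le_mul' hx hx
    _ = ENNReal.ofReal (c ^ 2) := by simp

end Pairs

/-! ### Volume of the part of a ball in a cone -/

section Cone

open scoped RealInnerProductSpace

variable {E : Type*} [NormedAddCommGroup E] [InnerProductSpace ℝ E]

lemma norm_sub_smul_sq {u : E} (hu : ‖u‖ = 1) (s : ℝ) (x : E) :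
    ‖x - s • u‖ ^ 2 = ‖x‖ ^ 2 - 2 * s * ⟪u, x⟫ + s ^ 2 := by
  rw [norm_sub_sq_real, norm_smul, hu, inner_smul_right, real_inner_comm, mul_one,
    Real.norm_eq_abs, sq_abs]
  ring

/-- With `s = a²` in `[1/2, 1]` the claim is `e^s ≤ 4s`. It follows from `e^s (2 - s) ≤ e < 3 ≤ 4s(2
- s)`. -/
lemma exp_sq_half_le {a : ℝ} (h0 : 0 ≤ a) (h1 : a ≤ 1) (h2 : 1 ≤ 2 * a ^ 2) :
    Real.exp (a ^ 2 / 2) ≤ 2 * a := by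
  have h3 : Real.exp (a ^ 2) ≤ (2 * a) ^ 2 := by
    have e1 : 2 - a ^ 2 ≤ Real.exp (1 - a ^ 2) := by
      linarith [Real.add_one_le_exp (1 - a ^ 2)]
    have e2 : Real.exp (a ^ 2) * Real.exp (1 - a ^ 2) = Real.exp 1 := by
      rw [← Real.exp_add]; congr 1; ring
    have e3 := Real.exp_one_lt_d9
    have e4 : a ^ 2 ≤ 1 := pow_le_one₀ h0 h1
    have e5 := mul_le_mul_of_nonneg_left e1 (Real.exp_pos (a ^ 2)).le
    have e6 : 0 ≤ (2 * a ^ 2 - 1) * (1 - a ^ 2) := mul_nonneg (by linarith) (by linarith)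
    by_contra! h
    have e7 := mul_lt_mul_of_pos_right h (show 0 < 2 - a ^ 2 by linarith)
    nlinarith
  refine le_of_sq_le_sq ?_ (by linarith)
  have h4 : ((2 : ℕ) : ℝ) * (a ^ 2 / 2) = a ^ 2 := by push_cast; ring
  rwa [← Real.exp_nat_mul, h4]

/-- The part of a ball that lies in a spherical cone is contained in a smaller ball. -/
lemma exists_cone_inter_ball_subset {u : E} (hu : ‖u‖ = 1) {a : ℝ} (h0 : 0 ≤ a) (h1 : a < 1) :
    ∃ κ : ℝ, 0 < κ ∧ κ ≤ Real.exp (-(a ^ 2 / 2)) ∧ ∀ r : ℝ, 0 < r →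
      ∃ c : E, {x : E | a * ‖x‖ < ⟪u, x⟫ ∧ ‖x‖ < r} ⊆ Metric.ball c (κ * r) := by
  have ha2 : a ^ 2 < 1 := pow_lt_one₀ h0 h1 two_ne_zero
  rcases le_total (2 * a ^ 2) 1 with h | h
  -- Wide cone: the ball is centred at the middle of the rim where cone and sphere meet; it reaches
  -- the apex because `a ≤ √(1 - a²)`.
  · refine ⟨√(1 - a ^ 2), Real.sqrt_pos.2 (by linarith), ?_, fun r hr => ⟨(r * a) • u, ?_⟩⟩
    · rw [Real.sqrt_le_left (Real.exp_pos _).le, ← Real.exp_nat_mul]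
      have := Real.add_one_le_exp (-a ^ 2)
      convert this using 1
      · ring
      · congr 1; push_cast; ring
    · rintro x ⟨hx, hxr⟩
      have hx0 : 0 < ‖x‖ := by
        rw [norm_pos_iff]
        rintro rfl
        simp at hx
      rw [mem_ball_iff_norm]
      have hs := Real.sq_sqrt (show 0 ≤ 1 - a ^ 2 by linarith)
      refine lt_of_pow_lt_pow_left₀ 2 (by positivity) ?_
      rw [norm_sub_smul_sq hu, mul_pow (√_), hs]
      have e1 : r * a * (a * ‖x‖) ≤ r * a * ⟪u, x⟫ :=
        mul_le_mul_of_nonneg_left hx.le (by positivity)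
      have e2 : 0 ≤ r * (1 - 2 * a ^ 2) := mul_nonneg hr.le (by linarith)
      have e3 : 0 < (r - ‖x‖) * (‖x‖ + r * (1 - 2 * a ^ 2)) :=
        mul_pos (by linarith) (by linarith)
      nlinarith
  · have ha : 0 < a := by
      rcases h0.eq_or_lt with rfl | ha
      · norm_num at h
      · exact ha
    -- Narrow cone: the ball whose boundary passes through both the apex and the rim.
    refine ⟨1 / (2 * a), by positivity, ?_, fun r hr => ⟨(r / (2 * a)) • u, ?_⟩⟩
    · rw [Real.exp_neg, ← one_div]
      exact one_div_le_one_div_of_le (Real.exp_pos _) (exp_sq_half_le h0 h1.le h)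
    · rintro x ⟨hx, hxr⟩
      rw [mem_ball_iff_norm]
      refine lt_of_pow_lt_pow_left₀ 2 (by positivity) ?_
      rw [norm_sub_smul_sq hu]
      have e1 : 2 * (r / (2 * a)) * (a * ‖x‖) < 2 * (r / (2 * a)) * ⟪u, x⟫ :=
        mul_lt_mul_of_pos_left hx (by positivity)
      have e2 : 2 * (r / (2 * a)) * (a * ‖x‖) = r * ‖x‖ := by field_simp
      have e3 : 1 / (2 * a) * r = r / (2 * a) := by ring
      have e4 : ‖x‖ * ‖x‖ ≤ r * ‖x‖ := mul_le_mul_of_nonneg_right hxr.le (norm_nonneg _)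
      rw [e3]
      nlinarith

lemma volume_cone_inter_ball_le {m : ℕ} {u : EuclideanSpace ℝ (Fin m)} (hu : ‖u‖ = 1)
    {a : ℝ} (h0 : 0 ≤ a) (h1 : a < 1) {r : ℝ} (hr : 0 < r) :
    volume {x : EuclideanSpace ℝ (Fin m) | a * ‖x‖ < ⟪u, x⟫ ∧ ‖x‖ < r} ≤
      ENNReal.ofReal (Real.exp (-(m * a ^ 2 / 2))) *
        volume {x : EuclideanSpace ℝ (Fin m) | ‖x‖ < r} := by
  obtain ⟨κ, hκ, hκ', h⟩ := exists_cone_inter_ball_subset hu h0 h1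
  obtain ⟨c, hc⟩ := h r hr
  refine (measure_mono hc).trans ?_
  have : {x : EuclideanSpace ℝ (Fin m) | ‖x‖ < r} = Metric.ball 0 r := by
    ext x; simp
  rw [this, Measure.addHaar_ball_mul_of_pos _ _ hκ, finrank_euclideanSpace_fin]
  gcongr
  calc κ ^ m ≤ Real.exp (-(a ^ 2 / 2)) ^ m := pow_le_pow_left₀ hκ.le hκ' m
    _ = Real.exp (-(m * a ^ 2 / 2)) := by
      rw [← Real.exp_nat_mul]; congr 1; ring

end Cone

/-! ### Cone probabilities for Gaussian and Bernoulli vectors -/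

section Tail

variable {m : ℕ}

lemma l2norm_nonneg (x : Fin m → ℝ) : 0 ≤ l2norm x := norm_nonneg _

lemma l2norm_sq (x : Fin m → ℝ) : l2norm x ^ 2 = ∑ i, x i ^ 2 := by
  simp [l2norm, EuclideanSpace.norm_sq_eq]

lemma measurable_l2norm : Measurable (l2norm : (Fin m → ℝ) → ℝ) :=
  (PiLp.continuous_toLp 2 _).norm.measurable

lemma l2norm_neg (x : Fin m → ℝ) : l2norm (-x) = l2norm x := by
  simp [l2norm]

lemma inner_toLp (x y : Fin m → ℝ) : inner ℝ (WithLp.toLp 2 x) (WithLp.toLp 2 y) = x ⬝ᵥ y := by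
  rw [EuclideanSpace.inner_toLp_toLp, star_trivial, dotProduct_comm]

lemma volume_cone_inter_l2norm_lt_le {u : Fin m → ℝ} (hu : l2norm u = 1)
    {a : ℝ} (h0 : 0 ≤ a) (h1 : a < 1) {r : ℝ} (hr : 0 < r) :
    volume {x : Fin m → ℝ | a * l2norm x < u ⬝ᵥ x ∧ l2norm x < r} ≤
      ENNReal.ofReal (Real.exp (-(m * a ^ 2 / 2))) * volume {x : Fin m → ℝ | l2norm x < r} := by
  have h := volume_cone_inter_ball_le hu h0 h1 hr
  rw [← (PiLp.volume_preserving_toLp (Fin m)).measure_preimage,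
    ← (PiLp.volume_preserving_toLp (Fin m)).measure_preimage] at h
  · simpa only [Set.preimage_ofPred_eq, inner_toLp] using! h
  · exact (measurable_norm measurableSet_Iio).nullMeasurableSet
  · have h2 : MeasurableSet {x : EuclideanSpace ℝ (Fin m) |
        a * ‖x‖ < inner ℝ (WithLp.toLp 2 u) x} := measurableSet_lt (by fun_prop) (by fun_prop)
    exact (h2.inter (measurable_norm measurableSet_Iio)).nullMeasurableSet

lemma pi_gaussianReal_eq_withDensity {v : ℝ≥0} (hv : v ≠ 0) :
    Measure.pi (fun _ : Fin m => gaussianReal 0 v) =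
      (volume : Measure (Fin m → ℝ)).withDensity
        (fun x => ENNReal.ofReal (∏ i, gaussianPDFReal 0 v (x i))) := by
  refine Measure.pi_eq fun s hs => ?_
  rw [withDensity_apply _ (MeasurableSet.univ_pi hs), volume_pi,
    Measure.restrict_pi_pi (fun _ => volume),
    ← ofReal_integral_eq_lintegral_ofReal,
    integral_fintype_prod_eq_prod (fun _ : Fin m => gaussianPDFReal 0 v),
    ENNReal.ofReal_prod_of_nonneg fun i _ =>
      integral_nonneg fun x => gaussianPDFReal_nonneg 0 v x]
  · exact Finset.prod_congr rfl fun i _ => (gaussianReal_apply_eq_integral 0 hv (s i)).symm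
  · exact Integrable.fintype_prod fun i => (integrable_gaussianPDFReal 0 v).restrict
  · exact Filter.Eventually.of_forall fun x =>
      Finset.prod_nonneg fun i _ => gaussianPDFReal_nonneg 0 v _

lemma prod_gaussianPDFReal_eq (v : ℝ≥0) (x : Fin m → ℝ) :
    ∏ i, gaussianPDFReal 0 v (x i)
      = (√(2 * Real.pi * v))⁻¹ ^ m * Real.exp (-l2norm x ^ 2 / (2 * v)) := by
  simp only [gaussianPDFReal, sub_zero, Finset.prod_mul_distrib, Finset.prod_const,
    Finset.card_univ, Fintype.card_fin, ← Real.exp_sum, l2norm_sq, neg_div, Finset.sum_neg_distrib,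
    Finset.sum_div]

/-- A superlevel set of a centred Gaussian density is a ball or empty. -/
lemma setOf_lt_mul_exp {b v t : ℝ} (hb : 0 < b) (hv : 0 < v) (ht : 0 < t) :
    {x : Fin m → ℝ | t < b * Real.exp (-l2norm x ^ 2 / (2 * v))} = ∅ ∨
      ∃ r : ℝ, 0 < r ∧
        {x : Fin m → ℝ | t < b * Real.exp (-l2norm x ^ 2 / (2 * v))} = {x | l2norm x < r} := by
  have h : ∀ x : Fin m → ℝ, t < b * Real.exp (-l2norm x ^ 2 / (2 * v)) ↔
      l2norm x ^ 2 < -(2 * v * Real.log (t / b)) := fun x => by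
    rw [mul_comm b, ← div_lt_iff₀ hb, ← Real.log_lt_iff_lt_exp (div_pos ht hb),
      lt_div_iff₀ (by positivity)]
    constructor <;> intro h <;> linarith
  have he : {x : Fin m → ℝ | t < b * Real.exp (-l2norm x ^ 2 / (2 * v))}
      = {x | l2norm x ^ 2 < -(2 * v * Real.log (t / b))} := Set.ext h
  rw [he]
  rcases le_or_gt (-(2 * v * Real.log (t / b))) 0 with h0 | h0
  · left
    refine Set.eq_empty_of_forall_notMem fun x hx => ?_
    exact absurd (lt_of_lt_of_le hx h0) (not_lt.2 (sq_nonneg _))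
  · refine Or.inr ⟨√(-(2 * v * Real.log (t / b))), Real.sqrt_pos.2 h0, ?_⟩
    ext x
    exact (Real.lt_sqrt (l2norm_nonneg x)).symm

lemma measurableSet_cone (u : Fin m → ℝ) (a : ℝ) :
    MeasurableSet {x : Fin m → ℝ | a * l2norm x < u ⬝ᵥ x} := by
  have h : Measurable fun x : Fin m → ℝ => u ⬝ᵥ x := by
    unfold dotProduct
    fun_prop
  exact measurableSet_lt (measurable_l2norm.const_mul a) h

lemma dotProduct_le_l2norm_mul (x y : Fin m → ℝ) : x ⬝ᵥ y ≤ l2norm x * l2norm y := by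
  rw [← inner_toLp]
  exact real_inner_le_norm _ _

/-- The probability that a Gaussian vector lies in a spherical cone. -/
lemma pi_gaussianReal_cone_le {v : ℝ≥0} (hv : v ≠ 0) {u : Fin m → ℝ} (hu : l2norm u = 1)
    {a : ℝ} (h0 : 0 ≤ a) :
    (Measure.pi fun _ : Fin m => gaussianReal 0 v).real {x | a * l2norm x < u ⬝ᵥ x} ≤
      Real.exp (-(m * a ^ 2 / 2)) := by
  rcases le_or_gt 1 a with h1 | h1
  · have : {x : Fin m → ℝ | a * l2norm x < u ⬝ᵥ x} = ∅ := by
      refine Set.eq_empty_of_forall_notMem fun x (hx : a * l2norm x < u ⬝ᵥ x) =>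
        absurd hx (not_lt.2 ?_)
      have e1 := dotProduct_le_l2norm_mul u x
      rw [hu] at e1
      exact e1.trans (mul_le_mul_of_nonneg_right h1 (l2norm_nonneg x))
    rw [this, measureReal_empty]
    exact (Real.exp_pos _).le
  set K := ENNReal.ofReal (Real.exp (-(m * a ^ 2 / 2)))
  set b := (√(2 * Real.pi * v))⁻¹ ^ m
  have hv' : (0 : ℝ) < v := by exact_mod_cast pos_iff_ne_zero.2 hv
  have hb : 0 < b := by positivity
  set g : (Fin m → ℝ) → ℝ := fun x => b * Real.exp (-l2norm x ^ 2 / (2 * v))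
  have hg0 : ∀ x, 0 ≤ g x := fun x => by positivity
  have hgm : Measurable g := by
    have := measurable_l2norm (m := m)
    fun_prop
  have hdens : Measure.pi (fun _ : Fin m => gaussianReal 0 v) =
      (volume : Measure (Fin m → ℝ)).withDensity fun x => ENNReal.ofReal (g x) := by
    rw [pi_gaussianReal_eq_withDensity hv]
    simp_rw [prod_gaussianPDFReal_eq]
    rfl
  refine ENNReal.toReal_le_of_le_ofReal (Real.exp_pos _).le ?_
  have hC := measurableSet_cone u a
  -- Layer-cake formula: the volume bound holds on every superlevel set of the radial density, so it
  -- integrates to the same bound for the measure.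
  calc Measure.pi (fun _ : Fin m => gaussianReal 0 v) {x | a * l2norm x < u ⬝ᵥ x}
      = ∫⁻ t in Set.Ioi 0, volume.restrict {x | a * l2norm x < u ⬝ᵥ x} {x | t < g x} := by
        rw [hdens, withDensity_apply _ hC, lintegral_eq_lintegral_meas_lt _
          (Filter.Eventually.of_forall hg0) hgm.aemeasurable]
    _ ≤ ∫⁻ t in Set.Ioi 0, K * volume {x | t < g x} := by
        refine setLIntegral_mono' measurableSet_Ioi fun t ht => ?_
        rw [Measure.restrict_apply (measurableSet_lt measurable_const hgm)]
        rcases setOf_lt_mul_exp (m := m) hb hv' ht with h | ⟨r, hr, h⟩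
        · have h' : {x | t < g x} = ∅ := h
          simp [h']
        · have h' : {x | t < g x} = {x | l2norm x < r} := h
          rw [h', Set.inter_comm]
          exact volume_cone_inter_l2norm_lt_le hu h0 h1 hr
    _ = K * Measure.pi (fun _ : Fin m => gaussianReal 0 v) Set.univ := by
        rw [lintegral_const_mul' _ _ ENNReal.ofReal_ne_top, hdens,
          withDensity_apply _ MeasurableSet.univ, Measure.restrict_univ,
          lintegral_eq_lintegral_meas_lt _ (Filter.Eventually.of_forall hg0) hgm.aemeasurable]
    _ = K := by rw [measure_univ, mul_one]

instance isProbabilityMeasure_symmBernoulli : IsProbabilityMeasure (symmBernoulli m) :=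
  ⟨by simp [symmBernoulli, ENNReal.inv_two_add_inv_two]⟩

lemma ae_symmBernoulli {p : ℝ → Prop} (h1 : p (-(1 / √(m : ℝ)))) (h2 : p (1 / √(m : ℝ))) :
    ∀ᵐ x ∂symmBernoulli m, p x := by
  rw [symmBernoulli, ae_add_measure_iff, Measure.ae_ennreal_smul_measure_iff (by simp),
    Measure.ae_ennreal_smul_measure_iff (by simp)]
  simp only [ae_dirac_eq, Filter.eventually_pure]
  exact ⟨h1, h2⟩

lemma integral_id_symmBernoulli : ∫ x, x ∂symmBernoulli m = 0 := by
  rw [symmBernoulli, integral_add_measure]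
  · simp
  · exact (integrable_dirac (by simp)).smul_measure (by simp)
  · exact (integrable_dirac (by simp)).smul_measure (by simp)

/-- Hoeffding's lemma on an interval of half-length `1/√m`. -/
lemma hasSubgaussianMGF_symmBernoulli :
    HasSubgaussianMGF id (1 / (m : ℝ≥0)) (symmBernoulli m) := by
  have h := hasSubgaussianMGF_of_mem_Icc_of_integral_eq_zero (X := id) (μ := symmBernoulli m)
    (a := -(1 / √(m : ℝ))) (b := 1 / √(m : ℝ)) aemeasurable_id
    (ae_symmBernoulli ⟨le_rfl, neg_le_self (by positivity)⟩ ⟨neg_le_self (by positivity), le_rfl⟩)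
    integral_id_symmBernoulli
  convert h using 1
  ext
  push_cast
  rw [sub_neg_eq_add, ← two_mul, norm_mul, Real.norm_eq_abs, Real.norm_eq_abs,
    abs_of_nonneg (show (0 : ℝ) ≤ 1 / √m by positivity), abs_of_pos (two_pos),
    mul_div_cancel_left₀ _ two_ne_zero, div_pow, Real.sq_sqrt (by positivity), one_pow]

/-- The probability that a symmetric Bernoulli vector lies in a spherical cone. -/
lemma pi_symmBernoulli_cone_le (hm : 1 ≤ m) {u : Fin m → ℝ} (hu : l2norm u = 1)
    {a : ℝ} (h0 : 0 ≤ a) :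
    (Measure.pi fun _ : Fin m => symmBernoulli m).real {x | a * l2norm x < u ⬝ᵥ x} ≤
      Real.exp (-(m * a ^ 2 / 2)) := by
  have hm0 : (0 : ℝ) < m := by exact_mod_cast hm
  set μ := Measure.pi fun _ : Fin m => symmBernoulli m
  have hnorm : ∀ᵐ x ∂μ, l2norm x = 1 := by
    have : ∀ᵐ x ∂μ, ∀ i, x i ^ 2 = 1 / (m : ℝ) := by
      rw [ae_all_iff]
      intro i
      have h : ∀ᵐ y ∂symmBernoulli m, y ^ 2 = 1 / (m : ℝ) :=
        ae_symmBernoulli (p := fun y => y ^ 2 = 1 / (m : ℝ)) (by rw [neg_sq, div_pow, one_pow, Real.sq_sqrt hm0.le])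
          (by rw [div_pow, one_pow, Real.sq_sqrt hm0.le])
      exact (measurePreserving_eval (fun _ : Fin m => symmBernoulli m) i).quasiMeasurePreserving.ae h
    filter_upwards [this] with x hx
    have h : l2norm x ^ 2 = 1 := by
      rw [l2norm_sq]
      simp [hx, hm0.ne']
    exact (pow_eq_one_iff_of_nonneg (l2norm_nonneg x) two_ne_zero).1 h
  -- On the unit sphere the cone is the half-space `a < u ⬝ᵥ x`; the variance proxies `u i ^ 2 / m`
  -- add up to `1 / m`.
  have hsub : ∀ i ∈ Finset.univ, HasSubgaussianMGF (fun x : Fin m → ℝ => u i * x i)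
      (NNReal.mk (u i ^ 2) (sq_nonneg _) * (1 / (m : ℝ≥0))) μ := fun i _ => by
    have h := (measurePreserving_eval (fun _ : Fin m => symmBernoulli m) i)
    have h2 := hasSubgaussianMGF_symmBernoulli (m := m)
    rw [← h.map_eq] at h2
    exact (HasSubgaussianMGF.of_map h.measurable.aemeasurable h2).const_mul (u i)
  have hind : iIndepFun (fun (i : Fin m) (x : Fin m → ℝ) => u i * x i) μ :=
    iIndepFun_pi (X := fun i y => u i * y) fun i => (measurable_const_mul (u i)).aemeasurable
  have h := HasSubgaussianMGF.measure_sum_ge_le_of_iIndepFun hind hsub h0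
  refine le_trans ?_ (h.trans (le_of_eq ?_))
  · refine ENNReal.toReal_mono (measure_ne_top _ _) (measure_mono_ae ?_)
    filter_upwards [hnorm] with x hx hx'
    have hx'' : a * l2norm x < u ⬝ᵥ x := hx'
    rw [hx, mul_one] at hx''
    exact hx''.le
  · congr 1
    have : ((∑ i : Fin m, (NNReal.mk (u i ^ 2) (sq_nonneg _) * (1 / (m : ℝ≥0))) : ℝ≥0) : ℝ) = 1 / m := by
      push_cast
      rw [← Finset.sum_mul]
      have h := l2norm_sq u
      rw [hu, one_pow] at h
      simp [← h]
    rw [this]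
    field_simp

end Tail

/-! ### From cones to the coherence of two columns -/

section Coherent

variable {m : ℕ}

/-- The pairs of vectors whose normalized coherence exceeds `a`. -/
def coherentPairs (m : ℕ) (a : ℝ) : Set ((Fin m → ℝ) × (Fin m → ℝ)) :=
  {z | a < |(z.1 ⬝ᵥ z.2) / (l2norm z.1 * l2norm z.2)|}

lemma measurableSet_coherentPairs (a : ℝ) : MeasurableSet (coherentPairs m a) := by
  have h := measurable_l2norm (m := m)
  refine measurableSet_lt measurable_const (Measurable.abs (Measurable.div ?_ ?_))
  · unfold dotProduct
    fun_prop
  · fun_prop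

lemma mem_coherentPairs_comm (a : ℝ) (x y : Fin m → ℝ) :
    (x, y) ∈ coherentPairs m a ↔ (y, x) ∈ coherentPairs m a := by
  change a < |(x ⬝ᵥ y) / (l2norm x * l2norm y)| ↔ a < |(y ⬝ᵥ x) / (l2norm y * l2norm x)|
  rw [dotProduct_comm, mul_comm]

/-- A bound for spherical cones bounds the probability that the coherence of a given vector with
a random one is large. -/
lemma measureReal_mk_preimage_coherentPairs_le {μ : Measure (Fin m → ℝ)} [IsProbabilityMeasure μ]
    {a c : ℝ} (ha : 0 ≤ a) (hc : 0 ≤ c)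
    (hcone : ∀ u : Fin m → ℝ, l2norm u = 1 → μ.real {x | a * l2norm x < u ⬝ᵥ x} ≤ c)
    (x : Fin m → ℝ) : μ.real (Prod.mk x ⁻¹' coherentPairs m a) ≤ 2 * c := by
  -- For a zero vector division by zero makes the coherence 0, which does not exceed `a ≥ 0`.
  rcases (l2norm_nonneg x).eq_or_lt with hx | hx
  · have : Prod.mk x ⁻¹' coherentPairs m a = ∅ := by
      refine Set.eq_empty_of_forall_notMem fun y hy => ?_
      have hy' : a < |(x ⬝ᵥ y) / (l2norm x * l2norm y)| := hy
      rw [← hx, zero_mul, div_zero, abs_zero] at hy'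
      exact absurd hy' (not_lt.2 ha)
    rw [this, measureReal_empty]
    positivity
  set u : Fin m → ℝ := (l2norm x)⁻¹ • x with hu
  have hu1 : l2norm u = 1 := by
    rw [hu, l2norm, WithLp.toLp_smul, norm_smul, Real.norm_eq_abs, abs_inv,
      abs_of_pos hx]
    exact inv_mul_cancel₀ hx.ne'
  have hsub : Prod.mk x ⁻¹' coherentPairs m a ⊆
      {y | a * l2norm y < u ⬝ᵥ y} ∪ {y | a * l2norm y < (-u) ⬝ᵥ y} := fun y hy => by
    have hy' : a < |(x ⬝ᵥ y) / (l2norm x * l2norm y)| := hy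
    have hy0 : 0 < l2norm y := by
      refine (l2norm_nonneg y).lt_of_ne fun h => ?_
      rw [← h, mul_zero, div_zero, abs_zero] at hy'
      exact absurd hy' (not_lt.2 ha)
    have e : (x ⬝ᵥ y) / (l2norm x * l2norm y) = (u ⬝ᵥ y) / l2norm y := by
      rw [hu, smul_dotProduct, smul_eq_mul]
      field_simp
    rw [e, lt_abs, ← neg_div, lt_div_iff₀ hy0, lt_div_iff₀ hy0, ← neg_dotProduct] at hy'
    exact hy'
  calc μ.real (Prod.mk x ⁻¹' coherentPairs m a)
      ≤ μ.real ({y | a * l2norm y < u ⬝ᵥ y} ∪ {y | a * l2norm y < (-u) ⬝ᵥ y}) :=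
        measureReal_mono hsub
    _ ≤ c + c := (measureReal_union_le _ _).trans
        (add_le_add (hcone u hu1) (hcone (-u) (by rwa [l2norm_neg])))
    _ = 2 * c := (two_mul c).symm

variable {n : ℕ}

lemma mutualCoherence_le_iff (hn : 2 ≤ n) (A : Matrix (Fin m) (Fin n) ℝ) (a : ℝ) :
    mutualCoherence A ≤ a ↔ ∀ S : ColSet n 2, kernel (colSubmatrix A S) ≤ a := by
  have : Nonempty (ColSet n 2) := by
    rw [← Fintype.card_pos_iff, card_colSet]
    exact Nat.choose_pos hn
  exact ciSup_le_iff (Set.finite_range _).bddAbove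

end Coherent

/-! ### Numerical estimates for the Poisson error -/

section Bounds

lemma one_sub_exp_neg_nonneg {x : ℝ} (hx : 0 ≤ x) : 0 ≤ 1 - Real.exp (-x) :=
  sub_nonneg.2 (Real.exp_le_one_iff.2 (neg_nonpos.2 hx))

lemma one_sub_exp_neg_le (x : ℝ) : 1 - Real.exp (-x) ≤ x := by
  linarith [Real.add_one_le_exp (-x)]

/-- Invert `e^x ≥ 1 + x + x²/2` and use `(1 + x + x²/2)(1 - x + x²/2) = 1 + x⁴/4 ≥ 1`. -/
lemma exp_neg_le_quadratic {x : ℝ} (hx : 0 ≤ x) : Real.exp (-x) ≤ 1 - x + x ^ 2 / 2 := by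
  have h := Real.quadratic_le_exp_of_nonneg hx
  rw [Real.exp_neg]
  refine inv_le_of_inv_le₀ (by nlinarith [sq_nonneg (x - 1)]) (le_trans ?_ h)
  rw [inv_le_iff_one_le_mul₀ (by nlinarith [sq_nonneg (x - 1)])]
  nlinarith [sq_nonneg (x ^ 2)]

lemma unionBound_two_le {n : ℕ} (hn : 2 ≤ n) {p : ℝ} (hp : 0 ≤ p) :
    unionBound n 2 p ≤ (n : ℝ) ^ 2 / 2 * p := by
  have hn' : (2 : ℝ) ≤ n := by exact_mod_cast hn
  rw [unionBound, Nat.cast_choose_two]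
  exact mul_le_mul_of_nonneg_right (by nlinarith) hp

/-- No lower bound on `p` is needed for `q / p`: the prefactor satisfies `1 - e^{-λ} ≤ λ ≤ n² p /
2`, which cancels `p⁻¹`. -/
lemma poissonError_two_le {n : ℕ} (hn : 2 ≤ n) {p q e : ℝ} (hp : 0 ≤ p) (hp' : p ≤ 2 * e)
    (hq : 0 ≤ q) (hq' : q ≤ (2 * e) ^ 2) :
    poissonError n 2 p (fun _ => q) ≤
      (1 - Real.exp (-unionBound n 2 p)) * ((4 * (n : ℝ) - 6) * e) + 4 * (n : ℝ) ^ 3 * e ^ 2 := by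
  have hn' : (2 : ℝ) ≤ n := by exact_mod_cast hn
  have hlam : 0 ≤ unionBound n 2 p := mul_nonneg (Nat.cast_nonneg _) hp
  have h1 := one_sub_exp_neg_nonneg hlam
  have h2 := (one_sub_exp_neg_le (unionBound n 2 p)).trans (unionBound_two_le hn hp)
  set w := 1 - Real.exp (-unionBound n 2 p) with hw
  have hc : (n.choose 2 : ℝ) - ((n - 2).choose 2 : ℝ) = 2 * n - 3 := by
    rw [choose_two_eq hn]
    push_cast [hn]
    ring
  have hpe : poissonError n 2 p (fun _ => q)
      = w * (p * (2 * n - 3)) + 2 * ((n : ℝ) - 2) * (w * (p⁻¹ * q)) := by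
    rw [poissonError, hc]
    simp only [Nat.add_one_sub_one, Finset.Icc_self, Finset.sum_singleton,
      Nat.choose_one_right, Nat.cast_ofNat, ← hw]
    push_cast [hn]
    ring
  rw [hpe]
  have h3 : w * (p * (2 * n - 3)) ≤ w * ((4 * (n : ℝ) - 6) * e) :=
    mul_le_mul_of_nonneg_left (by nlinarith) h1
  have h4 : w * (p⁻¹ * q) ≤ (n : ℝ) ^ 2 / 2 * q := by
    rcases hp.eq_or_lt with rfl | hp0
    · rw [inv_zero, zero_mul, mul_zero]
      positivity
    · calc w * (p⁻¹ * q) ≤ (n : ℝ) ^ 2 / 2 * p * (p⁻¹ * q) :=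
            mul_le_mul_of_nonneg_right h2 (by positivity)
        _ = (n : ℝ) ^ 2 / 2 * q := by field_simp
  have h5 : 2 * ((n : ℝ) - 2) * (w * (p⁻¹ * q)) ≤ 2 * ((n : ℝ) - 2) * ((n : ℝ) ^ 2 / 2 * q) :=
    mul_le_mul_of_nonneg_left h4 (by linarith)
  have h6 : 2 * ((n : ℝ) - 2) * ((n : ℝ) ^ 2 / 2 * q) ≤ (n : ℝ) ^ 3 * q := by
    have : 0 ≤ (n : ℝ) ^ 2 * q := by positivity
    nlinarith
  have h7 : (n : ℝ) ^ 3 * q ≤ (n : ℝ) ^ 3 * (2 * e) ^ 2 :=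
    mul_le_mul_of_nonneg_left hq' (by positivity)
  linarith

/-- The hypothesis says `m a²/2 ≥ 2 log n + m t`; the resulting factor `n⁻²` compensates the number
of pairs. -/
lemma exp_neg_le_of_sqrt_le {m n : ℕ} (hm : 1 ≤ m) (hn : 2 ≤ n) {a t : ℝ} (ha : 0 ≤ a)
    (h : √(4 * Real.log n / m + 2 * t) ≤ a) :
    Real.exp (-((m : ℝ) * a ^ 2 / 2)) ≤ Real.exp (-((m : ℝ) * t)) / (n : ℝ) ^ 2 := by
  have hm' : (0 : ℝ) < m := by exact_mod_cast hm
  have hn' : (0 : ℝ) < n := by positivity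
  rw [Real.sqrt_le_left ha] at h
  have h1 := mul_le_mul_of_nonneg_left h hm'.le
  have h2 : (m : ℝ) * (4 * Real.log n / m + 2 * t) = 4 * Real.log n + 2 * (m * t) := by
    field_simp
  have h3 : (n : ℝ) ^ 2 = Real.exp (2 * Real.log n) := by
    rw [two_mul, Real.exp_add, Real.exp_log hn', sq]
  rw [h3, ← Real.exp_sub, Real.exp_le_exp]
  linarith

end Bounds

end Coherence

/-! ### The main theorem -/

theorem theorem2 {Ω : Type*} [MeasurableSpace Ω] (P : Measure Ω) [IsProbabilityMeasure P]
    (m n : ℕ) (hm : 1 ≤ m) (hn : 2 ≤ n)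
    (A : Ω → Matrix (Fin m) (Fin n) ℝ) (ν : Measure ℝ)
    (hν : ν = gaussianReal 0 (1 / (m : ℝ≥0)) ∨ ν = Coherence.symmBernoulli m)
    (hA : Coherence.IIDColumns P A ν)
    (a : ℝ) (ha : 0 ≤ a)
    (S R : Coherence.ColSet n 2) (hSR : (S.1 ∩ R.1).card = 1 ∨ n = 2)
    (p q lam eps : ℝ)
    (hp : p = Coherence.marginalTail P A a S)
    (hq : q = Coherence.jointTail P A a S R)
    (hlam : lam = Coherence.unionBound n 2 p)
    (heps : eps = Coherence.poissonError n 2 p (fun _ => q)) :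
    -- `eps` is an error bound for the Poisson approximation
    |P.real {ω | Coherence.mutualCoherence (A ω) ≤ a} - Real.exp (-lam)| ≤ eps ∧
    -- the bound on the Poisson approximation error
    eps ≤ (1 - Real.exp (-lam)) * ((4 * (n : ℝ) - 6) * Real.exp (-((m : ℝ) * a ^ 2 / 2)))
      + 4 * (n : ℝ) ^ 3 * Real.exp (-((m : ℝ) * a ^ 2)) ∧
    -- `lam` is a union bound, and it is tight up to second order and `eps`
    P.real {ω | a < Coherence.mutualCoherence (A ω)} ≤ lam ∧
    lam - P.real {ω | a < Coherence.mutualCoherence (A ω)} ≤ lam ^ 2 / 2 + eps ∧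
    -- above the threshold `√(4 log n / m)` the union bound and the error decay exponentially in
    -- `m`, the error at twice the rate
    ∀ t : ℝ, 0 ≤ t → √(4 * Real.log n / m + 2 * t) ≤ a →
      lam ≤ Real.exp (-((m : ℝ) * t)) ∧ eps ≤ 8 / (n : ℝ) * Real.exp (-(2 * (m : ℝ) * t)) := by
  open Coherence in
  have hm0 : (m : ℝ≥0) ≠ 0 := by exact_mod_cast (by omega : m ≠ 0)
  have hprob : IsProbabilityMeasure ν := by
    rcases hν with rfl | rfl <;> infer_instance
  set e : ℝ := Real.exp (-((m : ℝ) * a ^ 2 / 2)) with he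
  have he0 : 0 < e := Real.exp_pos _
  have he2 : e ^ 2 = Real.exp (-((m : ℝ) * a ^ 2)) := by
    rw [he, ← Real.exp_nat_mul]
    congr 1
    push_cast
    ring
  have hcone : ∀ u : Fin m → ℝ, l2norm u = 1 →
      (Measure.pi fun _ : Fin m => ν).real {x | a * l2norm x < u ⬝ᵥ x} ≤ e := fun u hu => by
    rcases hν with rfl | rfl
    · exact pi_gaussianReal_cone_le (one_div_ne_zero hm0) hu ha
    · exact pi_symmBernoulli_cone_le hm hu ha
  set μ : Measure (Fin m → ℝ) := Measure.pi fun _ => ν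
  set D := coherentPairs m a
  have hD : MeasurableSet D := measurableSet_coherentPairs a
  have hsymm := mem_coherentPairs_comm (m := m) a
  have hsec := measureReal_mk_preimage_coherentPairs_le ha he0.le hcone
  have hp0 : 0 ≤ pairProb μ D := measureReal_nonneg
  have hp2 : pairProb μ D ≤ 2 * e := pairProb_le hD (by positivity) hsec
  have hq0 : 0 ≤ pathProb μ D := measureReal_nonneg
  have hq2 : pathProb μ D ≤ (2 * e) ^ 2 := pathProb_le hD (by positivity) hsec
  -- all the events depend on the law of the matrix of columns only
  set Q : Measure (Fin n → Fin m → ℝ) := Measure.pi fun _ => μ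
  have hY : HasLaw (fun ω j i => A ω i j) Q P := by
    have hae : ∀ j, AEMeasurable (fun ω i => A ω i j) P := fun j => (hA.law j).aemeasurable
    refine ⟨aemeasurable_pi_lambda _ hae, ?_⟩
    rw [hA.indep.map_fun_eq_pi_map hae]
    exact congrArg Measure.pi (funext fun j => (hA.law j).map_eq)
  have hYs : ∀ s, MeasurableSet s → P.real {ω | (fun j i => A ω i j) ∈ s} = Q.real s :=
    fun s hs => hY.measureReal_eq (p := fun y => y ∈ s) hs
  -- The columns of `A` are only a.e. measurable; the coordinates on the product space are
  -- measurable and have the same joint law.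
  let X : Fin n → (Fin n → Fin m → ℝ) → Fin m → ℝ := fun j z => z j
  have hX : ∀ j, Measurable (X j) := fun j => measurable_pi_apply j
  have hlaw : ∀ j, Q.map (X j) = μ := fun j => (measurePreserving_eval (fun _ => μ) j).map_eq
  have hind : iIndepFun X Q :=
    iIndepFun_pi (μ := fun _ : Fin n => μ) (X := fun _ z => z) fun _ => aemeasurable_id
  have hE := measurableSet_pairEvent (X := X) hX hD
  have hmarg : p = pairProb μ D := by
    rw [hp, ← measureReal_pairEvent hX hind hlaw hD S]
    exact hYs _ (hE S)
  have hpois : eps = poissonError n 2 p (fun _ => pathProb μ D) := by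
    rw [heps]
    rcases hSR with h | rfl
    · rw [hq, ← measureReal_pairEvent_inter hX hind hlaw hD hsymm h]
      exact congrArg (fun x => poissonError n 2 p (fun _ => x))
        (hYs _ ((hE S).inter (hE R)))
    -- For `n = 2` the coefficient of `q` contains `(n - 2).choose 1 = 0`, so the value of `q` is
    -- irrelevant.
    · simp [poissonError]
  have hno : P.real {ω | mutualCoherence (A ω) ≤ a} = Q.real (⋂ S, (pairEvent X D S)ᶜ) := by
    rw [← hYs _ (MeasurableSet.iInter fun S => (hE S).compl)]
    congr 1
    ext ω
    simp only [Set.mem_ofPred_eq, mutualCoherence_le_iff hn, Set.mem_iInter, Set.mem_compl_iff]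
    exact forall_congr' fun S => not_lt.symm
  have hyes : P.real {ω | a < mutualCoherence (A ω)}
      = 1 - P.real {ω | mutualCoherence (A ω) ≤ a} := by
    have h1 : P.real {ω | a < mutualCoherence (A ω)} = Q.real (⋃ S, pairEvent X D S) := by
      rw [← hYs _ (MeasurableSet.iUnion hE)]
      congr 1
      ext ω
      simp only [Set.mem_ofPred_eq, ← not_le, mutualCoherence_le_iff hn, Set.mem_iUnion,
        not_forall]
      exact exists_congr fun S => not_le
    rw [h1, hno, ← Set.compl_iUnion, probReal_compl_eq_one_sub (MeasurableSet.iUnion hE),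
      sub_sub_cancel]
  have hunion : P.real {ω | a < mutualCoherence (A ω)} ≤ lam := by
    have h1 : ∑ S : ColSet n 2, Q.real (pairEvent X D S) = lam := by
      simp_rw [measureReal_pairEvent hX hind hlaw hD]
      rw [Finset.sum_const, Finset.card_univ, card_colSet, nsmul_eq_mul, hlam, unionBound, hmarg]
    rw [hyes, hno, ← Set.compl_iUnion, probReal_compl_eq_one_sub (MeasurableSet.iUnion hE),
      sub_sub_cancel, ← h1]
    exact measureReal_iUnion_fintype_le _
  have hmain : |P.real {ω | mutualCoherence (A ω) ≤ a} - Real.exp (-lam)| ≤ eps := by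
    rw [hno, hpois, hlam, hmarg]
    exact abs_measureReal_iInter_pairEvent_compl_sub_exp_le hn hX hind hlaw hD hsymm
  rw [← hmarg] at hp0 hp2
  have hlam0 : 0 ≤ lam := hlam ▸ mul_nonneg (Nat.cast_nonneg _) hp0
  have heps2 : eps ≤ (1 - Real.exp (-lam)) * ((4 * (n : ℝ) - 6) * e) + 4 * (n : ℝ) ^ 3 * e ^ 2 := by
    rw [hpois, hlam]
    exact poissonError_two_le hn hp0 hp2 hq0 hq2
  refine ⟨hmain, he2 ▸ heps2, hunion, ?_, fun t _ hat => ?_⟩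
  · rw [hyes]
    linarith [(abs_le.1 hmain).2, exp_neg_le_quadratic hlam0]
  · have hn' : (2 : ℝ) ≤ n := by exact_mod_cast hn
    have het := exp_neg_le_of_sqrt_le hm hn ha hat
    rw [← he] at het
    have hT2 : Real.exp (-(2 * (m : ℝ) * t)) = Real.exp (-((m : ℝ) * t)) ^ 2 := by
      rw [← Real.exp_nat_mul]
      congr 1
      push_cast
      ring
    rw [hT2]
    set T := Real.exp (-((m : ℝ) * t))
    have hT0 : 0 < T := Real.exp_pos _
    have hlamT : lam ≤ T := by
      calc lam ≤ (n : ℝ) ^ 2 / 2 * p := hlam ▸ unionBound_two_le hn hp0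
        _ ≤ (n : ℝ) ^ 2 / 2 * (2 * (T / (n : ℝ) ^ 2)) := by gcongr; linarith
        _ = T := by field_simp
    refine ⟨hlamT, heps2.trans ?_⟩
    have h1 : (1 - Real.exp (-lam)) * ((4 * (n : ℝ) - 6) * e) ≤ T * (4 * n * (T / (n : ℝ) ^ 2)) := by
      refine mul_le_mul ((one_sub_exp_neg_le lam).trans hlamT)
        (mul_le_mul (by linarith) het he0.le (by positivity))
        (mul_nonneg (by linarith) he0.le) hT0.le
    have h2 : 4 * (n : ℝ) ^ 3 * e ^ 2 ≤ 4 * (n : ℝ) ^ 3 * (T / (n : ℝ) ^ 2) ^ 2 := by gcongr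
    -- Each of the two terms equals `4 T² / n`.
    refine (add_le_add h1 h2).trans (le_of_eq ?_)
    field_simp
    norm_num
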